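/- Let $D=(V,A)$ be a finite digraph (loops, parallel and antiparallel arcs are allowed). For $C\subseteq A$ let $A/C$ denote the minor of $D$ obtained by contracting the arcs of $C$: its vertices are the connected components of $(V,C)$, and its arcs are those in $A\setminus C$. Let $rk(A/C)$ be the rank of its incidence matrix, i.e. its number of vertices minus its number of connected components. Let $\mathcal{C}$ be the poset of all $A/C$ with $C$ a union of (finitely many, possibly zero) directed cycles of $D$, ordered by inclusion of the contracted sets $C$, so that $A=A/\emptyset$ is the least element, and let $\mu$ be its Möbius function. The NL-coflow polynomial of $D$ is $$\psi_{NL}^D(x)=\sum_{Y\in\mathcal{C}}\mu(A,Y)\,x^{rk(Y)}.$$ Let $Q$ be the set of all $B\subseteq A$ such that $D[B]$ is totally cyclic, that is, every connected component of $D[B]$ is strongly connected, ordered by inclusion (in particular $\emptyset\in Q$). For $B \in Q$ let $rk_Q(B)$ be the maximal length of a chain in $Q$ with top element $B$. Theorem. The poset $Q$ is graded with rank function $rk_Q$ (minimal elements have rank $0$, and $rk_Q(B')=rk_Q(B)+1$ whenever $B'$ covers $B$ in $Q$), and $$\psi_{NL}^D(x)=\sum_{B\in Q}(-1)^{rk_Q(B)}\,x^{rk(A/B)}.$$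 -/

import Mathlib

open Polynomial

/-- A digraph with vertex set `V` and arc set `A`. Loops, parallel arcs and antiparallel arcs are
allowed. -/
structure MultiDigraph (V A : Type*) where
  /-- The initial vertex of an arc. -/
  tail : A → V
  /-- The terminal vertex of an arc. -/
  head : A → V

namespace MultiDigraph

variable {V A : Type*}

/-- There is an arc from `u` to `v`. -/
def Adj (D : MultiDigraph V A) (u v : V) : Prop := ∃ a : A, D.tail a = u ∧ D.head a = v

/-- There is a directed walk (possibly of length zero) from `u` to `v`. -/
def Reachable (D : MultiDigraph V A) (u v : V) : Prop := Relation.ReflTransGen D.Adj u v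

/-- Two vertices are related when they lie in the same component of the underlying undirected
graph. -/
def weakSetoid (D : MultiDigraph V A) : Setoid V := Relation.EqvGen.setoid D.Adj

/-- Every component is strongly connected: any two vertices in the same component can be reached
from each other by directed walks. -/
def IsTotallyCyclic (D : MultiDigraph V A) : Prop :=
  ∀ u v : V, D.weakSetoid u v → D.Reachable u v ∧ D.Reachable v u

/-- The subdigraph `D[B]` given by a set `B` of arcs. All vertices of `D` are kept; a vertex that
meets no arc of `B` is a strongly connected component on its own, so that keeping it affects
neither the weak components with arcs nor total cyclicity. -/
def restrict (D : MultiDigraph V A) (B : Set A) : MultiDigraph V B where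
  tail a := D.tail a
  head a := D.head a

/-- The contraction `D / C`: the vertices are the components of `(V, C)`, the arcs are the arcs
outside `C` (those that join two vertices of one component become loops). -/
def contract (D : MultiDigraph V A) (C : Set A) :
    MultiDigraph (Quotient (D.restrict C).weakSetoid) {a : A // a ∉ C} where
  tail a := Quotient.mk _ (D.tail a)
  head a := Quotient.mk _ (D.head a)

open Classical in
/-- The incidence matrix of a digraph; the column of a loop is zero. -/
noncomputable def incidenceMatrix (D : MultiDigraph V A) : Matrix V A ℚ :=
  Matrix.of fun v a => (if D.head a = v then 1 else 0) - (if D.tail a = v then 1 else 0)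

/-- The rank of a digraph, that is, the rank of its incidence matrix. -/
noncomputable def rk [Fintype A] (D : MultiDigraph V A) : ℕ := D.incidenceMatrix.rank

open Classical in
/-- The rank `rk(A / C)` of the minor obtained by contracting the arcs of `C`. -/
noncomputable def rkContract [Fintype A] (D : MultiDigraph V A) (C : Set A) : ℕ :=
  (D.contract C).rk

/-- `C` is the arc set of a directed cycle: a closed directed walk of length `n + 1 ≥ 1` through
pairwise distinct vertices. The addition in `Fin (n + 1)` is modulo `n + 1`. A loop is a directed
cycle of length `1`. -/
def IsDirectedCycle (D : MultiDigraph V A) (C : Set A) : Prop :=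
  ∃ (n : ℕ) (a : Fin (n + 1) → A),
    Function.Injective (fun i => D.tail (a i)) ∧
    (∀ i, D.head (a i) = D.tail (a (i + 1))) ∧
    C = Set.range a

/-- `C` is a union of (finitely many, possibly zero) directed cycles. -/
def IsCycleUnion (D : MultiDigraph V A) (C : Set A) : Prop :=
  ∃ (r : ℕ) (S : Fin r → Set A), (∀ i, D.IsDirectedCycle (S i)) ∧ C = ⋃ i, S i

/-- The poset of all minors `A / C`, where `C` is a union of directed cycles. The element `C` of
this type stands for `A / C`, and the order is inclusion of the contracted sets `C`, so that
`A = A / ∅` is the least element. -/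
abbrev CyclePoset (D : MultiDigraph V A) : Type _ := {C : Set A // D.IsCycleUnion C}

/-- The poset `Q` of all `B ⊆ A` for which `D[B]` is totally cyclic, ordered by inclusion. -/
abbrev TotallyCyclicPoset (D : MultiDigraph V A) : Type _ :=
  {B : Set A // (D.restrict B).IsTotallyCyclic}

theorem isCycleUnion_empty (D : MultiDigraph V A) : D.IsCycleUnion ∅ :=
  ⟨0, Fin.elim0, fun i => i.elim0, by simp⟩

/-- The element `A = A / ∅` of the poset of minors. -/
def CyclePoset.all (D : MultiDigraph V A) : D.CyclePoset := ⟨∅, D.isCycleUnion_empty⟩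

noncomputable instance [Fintype A] (D : MultiDigraph V A) : Fintype D.CyclePoset :=
  Fintype.ofFinite _

noncomputable instance [Fintype A] (D : MultiDigraph V A) : Fintype D.TotallyCyclicPoset :=
  Fintype.ofFinite _

open Classical in
noncomputable instance [Fintype A] (D : MultiDigraph V A) : LocallyFiniteOrder D.CyclePoset :=
  Fintype.toLocallyFiniteOrder

open Classical in
/-- The NL-coflow polynomial `∑ μ(A, Y) x ^ rk(Y)`, summed over all `Y = A / C` in the poset of
minors, where `μ` is the Möbius function of that poset. -/
noncomputable def nlCoflowPolynomial [Fintype A] (D : MultiDigraph V A) : ℤ[X] :=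
  ∑ Y : D.CyclePoset,
    Polynomial.C (IncidenceAlgebra.mu ℤ (CyclePoset.all D) Y) * X ^ D.rkContract Y.1

/-- The rank `rk_Q(B)` in the poset `Q`: the maximal length of a chain of `Q` with top element
`B`. -/
noncomputable def rkQ (D : MultiDigraph V A) (B : D.TotallyCyclicPoset) : ℕ :=
  (Order.height B).toNat

end MultiDigraph

/-- `r` is a rank function: minimal elements have rank zero and the rank goes up by exactly one
along every covering relation. A finite poset is graded when it has a rank function. -/
def IsRankFunction {P : Type*} [PartialOrder P] (r : P → ℕ) : Prop :=
  (∀ x, IsMin x → r x = 0) ∧ ∀ x y, x ⋖ y → r y = r x + 1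

/-! Everything takes place in the cone of nonnegative rational circulations of $D$. The indicator of
a directed cycle is a circulation, and the support of a nonnegative circulation is totally cyclic,
since no flow can leave the set reachable from a vertex. Conversely, every arc of a totally cyclic
set lies on a directed cycle inside it. Hence $\mathcal{C}$ and $Q$ are the same poset
(`isCycleUnion_iff_isTotallyCyclic`), namely the supports of nonnegative circulations, i.e. the
faces of the cone.

The face with support $B$ spans the space `circulations B`. Its dimension grows by exactly one along
a covering (`finrank_circulations_of_covBy`), so it equals $rk_Q(B)$.

It remains to show $\mu(\emptyset, B) = (-1)^{\dim}$. By the recursion for $\mu$ this amounts to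
$\sum (-1)^{\dim F} = 0$ over the faces $F$ of a cone that is not a linear subspace: Euler's
relation, `coneEulerSum_eq_coneEulerChar`. Its proof is by induction on the number of inequalities:
both sides behave as valuations when a cone is cut by a hyperplane, so signs of functionals may be
reversed at will. -/

section ConeEuler

/-! ### Face sums of polyhedral cones and their behaviour under a hyperplane cut. -/

set_option linter.unusedSectionVars false

variable {𝕜 M ι : Type*} [Field 𝕜] [LinearOrder 𝕜] [IsStrictOrderedRing 𝕜]
  [AddCommGroup M] [Module 𝕜 M] [DecidableEq ι]

/-- The subspace of `W` on which all functionals `ℓ i`, `i ∈ S`, vanish. -/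
def infKer (W : Submodule 𝕜 M) (S : Finset ι) (ℓ : ι → M →ₗ[𝕜] 𝕜) : Submodule 𝕜 M :=
  W ⊓ ⨅ i ∈ S, LinearMap.ker (ℓ i)

/-- `B` is the support of a point of the cone `{x ∈ W | ∀ i ∈ S, 0 ≤ ℓ i x}`. -/
def IsConeFace (W : Submodule 𝕜 M) (S : Finset ι) (ℓ : ι → M →ₗ[𝕜] 𝕜) (B : Finset ι) : Prop :=
  ∃ x ∈ W, ∀ i ∈ S, (i ∈ B → 0 < ℓ i x) ∧ (i ∉ B → ℓ i x = 0)

/-- The cone `{x ∈ W | ∀ i ∈ S, 0 ≤ ℓ i x}` is not a linear subspace. -/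
def IsProperCone (W : Submodule 𝕜 M) (S : Finset ι) (ℓ : ι → M →ₗ[𝕜] 𝕜) : Prop :=
  ∃ x ∈ W, (∀ i ∈ S, 0 ≤ ℓ i x) ∧ ∃ i ∈ S, ℓ i x ≠ 0

open Classical in
/-- The alternating sum of the faces of a cone, each weighted by the parity of its dimension. -/
noncomputable def coneEulerSum (W : Submodule 𝕜 M) (S : Finset ι) (ℓ : ι → M →ₗ[𝕜] 𝕜) : ℤ :=
  ∑ B ∈ S.powerset,
    if IsConeFace W S ℓ B then (-1) ^ Module.finrank 𝕜 (infKer W (S \ B) ℓ) else 0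

open Classical in
/-- The value of `coneEulerSum`. -/
noncomputable def coneEulerChar (W : Submodule 𝕜 M) (S : Finset ι) (ℓ : ι → M →ₗ[𝕜] 𝕜) : ℤ :=
  if IsProperCone W S ℓ then 0 else (-1) ^ Module.finrank 𝕜 (infKer W S ℓ)

variable {W : Submodule 𝕜 M} {S : Finset ι} {ℓ : ι → M →ₗ[𝕜] 𝕜} {i : ι}

theorem mem_infKer {x : M} : x ∈ infKer W S ℓ ↔ x ∈ W ∧ ∀ i ∈ S, ℓ i x = 0 := by
  simp [infKer]

theorem infKer_inf_ker :
    infKer (W ⊓ LinearMap.ker (ℓ i)) S ℓ = infKer W S ℓ ⊓ LinearMap.ker (ℓ i) := by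
  simp only [infKer]; rw [inf_right_comm]

theorem infKer_insert :
    infKer W (insert i S) ℓ = infKer W S ℓ ⊓ LinearMap.ker (ℓ i) := by
  ext x; simp [mem_infKer]; tauto

theorem infKer_congr {ℓ' : ι → M →ₗ[𝕜] 𝕜} (h : ∀ i ∈ S, ∀ x, ℓ i x = 0 ↔ ℓ' i x = 0) :
    infKer W S ℓ = infKer W S ℓ' := by
  ext x; simp only [mem_infKer]
  exact and_congr_right fun _ => forall₂_congr fun i hi => h i hi x

theorem finrank_inf_ker_add_one [FiniteDimensional 𝕜 M] (N : Submodule 𝕜 M)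
    (f : M →ₗ[𝕜] 𝕜) (h : ∃ x ∈ N, f x ≠ 0) :
    Module.finrank 𝕜 (N ⊓ LinearMap.ker f : Submodule 𝕜 M) + 1 = Module.finrank 𝕜 N := by
  obtain ⟨x, hx, hfx⟩ := h
  have h0 : f.domRestrict N ≠ 0 := fun h => hfx (by simpa using LinearMap.congr_fun h ⟨x, hx⟩)
  have h1 := Module.Dual.finrank_ker_add_one_of_ne_zero (f := f.domRestrict N) h0
  have h2 : Submodule.map N.subtype (LinearMap.ker (f.domRestrict N)) =
      N ⊓ LinearMap.ker f := by
    ext y; simp [and_comm]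
  rw [← h2, Submodule.finrank_map_subtype_eq, ← h1]

theorem neg_one_pow_finrank_inf_ker [FiniteDimensional 𝕜 M] (N : Submodule 𝕜 M)
    (f : M →ₗ[𝕜] 𝕜) (h : ∃ x ∈ N, f x ≠ 0) :
    (-1 : ℤ) ^ Module.finrank 𝕜 N =
      -(-1) ^ Module.finrank 𝕜 (N ⊓ LinearMap.ker f : Submodule 𝕜 M) := by
  rw [← finrank_inf_ker_add_one N f h, pow_succ]
  ring

theorem isConeFace_inf_ker_iff {B : Finset ι} (hi : i ∉ B) :
    IsConeFace (W ⊓ LinearMap.ker (ℓ i)) S ℓ B ↔ IsConeFace W (insert i S) ℓ B := by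
  simp only [IsConeFace, Submodule.mem_inf, LinearMap.mem_ker, Finset.forall_mem_insert, hi]
  simp only [false_imp_iff, true_and, not_false_eq_true, true_imp_iff, and_assoc]

theorem isConeFace_insert_insert_iff {B : Finset ι} (hi : i ∉ S) :
    IsConeFace W (insert i S) ℓ (insert i B) ↔
      ∃ x ∈ W, 0 < ℓ i x ∧ ∀ j ∈ S, (j ∈ B → 0 < ℓ j x) ∧ (j ∉ B → ℓ j x = 0) := by
  have h : ∀ j ∈ S, (j ∈ insert i B ↔ j ∈ B) := fun j hj => by
    have : j ≠ i := fun h => hi (h ▸ hj)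
    simp [this]
  simp only [IsConeFace, Finset.forall_mem_insert, Finset.mem_insert_self, not_true_eq_false,
    false_imp_iff, true_imp_iff, and_true]
  refine exists_congr fun x => and_congr_right fun _ => and_congr_right fun _ =>
    forall₂_congr fun j hj => ?_
  rw [h j hj]

-- Faces whose support omits `i` lie in the hyperplane `ℓ i = 0`; the remaining ones lie strictly on
-- its positive side.
open Classical in
theorem coneEulerSum_insert (hi : i ∉ S) :
    coneEulerSum W (insert i S) ℓ =
      coneEulerSum (W ⊓ LinearMap.ker (ℓ i)) S ℓ +
      ∑ B ∈ S.powerset,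
        if ∃ x ∈ W, 0 < ℓ i x ∧ ∀ j ∈ S, (j ∈ B → 0 < ℓ j x) ∧ (j ∉ B → ℓ j x = 0)
        then (-1) ^ Module.finrank 𝕜 (infKer W (S \ B) ℓ) else 0 := by
  unfold coneEulerSum
  rw [Finset.sum_powerset_insert hi]
  congr 1
  · refine Finset.sum_congr rfl fun B hB => ?_
    have hiB : i ∉ B := fun h => hi (Finset.mem_powerset.1 hB h)
    rw [isConeFace_inf_ker_iff hiB, Finset.insert_sdiff_of_notMem _ hiB, infKer_insert,
      infKer_inf_ker]
  · refine Finset.sum_congr rfl fun B hB => ?_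
    rw [isConeFace_insert_insert_iff hi, Finset.insert_sdiff_insert,
      Finset.sdiff_insert_of_notMem hi]

theorem coneEulerSum_congr {ℓ' : ι → M →ₗ[𝕜] 𝕜} (h : ∀ i ∈ S, ℓ i = ℓ' i) :
    coneEulerSum W S ℓ = coneEulerSum W S ℓ' := by
  classical
  refine Finset.sum_congr rfl fun B _ => ?_
  have h1 : IsConeFace W S ℓ B ↔ IsConeFace W S ℓ' B :=
    exists_congr fun x => and_congr_right fun _ => forall₂_congr fun i hi => by rw [h i hi]
  rw [h1, infKer_congr fun i hi x => by rw [h i (Finset.mem_sdiff.1 hi).1]]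

/-- The functionals with the sign of `ℓ i` changed. -/
def flipSign (ℓ : ι → M →ₗ[𝕜] 𝕜) (i : ι) : ι → M →ₗ[𝕜] 𝕜 := Function.update ℓ i (-ℓ i)

theorem flipSign_self : flipSign ℓ i i = -ℓ i := by simp [flipSign]

theorem flipSign_of_ne {j : ι} (h : j ≠ i) : flipSign ℓ i j = ℓ j := by simp [flipSign, h]

theorem flipSign_of_mem (hi : i ∉ S) : ∀ j ∈ S, flipSign ℓ i j = ℓ j := fun _ hj =>
  flipSign_of_ne fun h => hi (h ▸ hj)

theorem flipSign_eq_zero_iff (j : ι) (x : M) : flipSign ℓ i j x = 0 ↔ ℓ j x = 0 := by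
  by_cases h : j = i
  · subst h; simp [flipSign_self]
  · rw [flipSign_of_ne h]

/-- The two half cones cover the cone and meet in its section by `ℓ i = 0`. Face by face: a
relatively open face that crosses the hyperplane splits into two open pieces of its own dimension
and a section of one dimension less, and `s - s - s = -s`; any other face lies in one piece. -/
theorem coneEulerSum_add_flipSign [FiniteDimensional 𝕜 M] (hi : i ∉ S) :
    coneEulerSum W (insert i S) ℓ + coneEulerSum W (insert i S) (flipSign ℓ i) =
      coneEulerSum W S ℓ + coneEulerSum (W ⊓ LinearMap.ker (ℓ i)) S ℓ := by
  classical
  have hker : LinearMap.ker (flipSign ℓ i i) = LinearMap.ker (ℓ i) := by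
    ext x; simp [flipSign_self]
  rw [coneEulerSum_insert hi, coneEulerSum_insert hi, hker,
    coneEulerSum_congr (flipSign_of_mem hi), add_add_add_comm, add_comm (coneEulerSum W S ℓ),
    add_assoc, add_right_inj]
  unfold coneEulerSum
  simp only [← Finset.sum_add_distrib]
  refine Finset.sum_congr rfl fun B hB => ?_
  rw [infKer_congr (ℓ := flipSign ℓ i) (ℓ' := ℓ) fun j _ x => flipSign_eq_zero_iff j x,
    infKer_inf_ker]
  have hflip : (∃ x ∈ W, 0 < flipSign ℓ i i x ∧ ∀ j ∈ S, (j ∈ B → 0 < flipSign ℓ i j x) ∧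
      (j ∉ B → flipSign ℓ i j x = 0)) ↔
      ∃ x ∈ W, ℓ i x < 0 ∧ ∀ j ∈ S, (j ∈ B → 0 < ℓ j x) ∧ (j ∉ B → ℓ j x = 0) := by
    refine exists_congr fun x => and_congr_right fun _ => and_congr (by simp [flipSign_self])
      (forall₂_congr fun j hj => by rw [flipSign_of_mem hi j hj])
  rw [hflip]
  set N := infKer W (S \ B) ℓ with hN
  have hmemN : ∀ x ∈ W, (∀ j ∈ S, (j ∈ B → 0 < ℓ j x) ∧ (j ∉ B → ℓ j x = 0)) → x ∈ N :=
    fun x hx h => mem_infKer.2 ⟨hx, fun j hj =>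
      (h j (Finset.mem_sdiff.1 hj).1).2 (Finset.mem_sdiff.1 hj).2⟩
  by_cases hz : ∃ x ∈ N, ℓ i x ≠ 0
  · rw [neg_one_pow_finrank_inf_ker N (ℓ i) hz]
    set s : ℤ := (-1) ^ Module.finrank 𝕜 (N ⊓ LinearMap.ker (ℓ i) : Submodule 𝕜 M)
    obtain ⟨z, hz, hiz⟩ := hz
    obtain ⟨hzW, hz0⟩ := mem_infKer.1 hz
    -- perturbation in the direction `z`
    have key : ∀ x ∈ W, (∀ j ∈ S, (j ∈ B → 0 < ℓ j x) ∧ (j ∉ B → ℓ j x = 0)) →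
        ∃ t : 𝕜, 0 < t ∧ ∀ j ∈ S, (j ∈ B → 0 < ℓ j (x + t • z) ∧ 0 < ℓ j (x - t • z)) ∧
          (j ∉ B → ℓ j (x + t • z) = 0 ∧ ℓ j (x - t • z) = 0) := by
      intro x hx hS
      have h1 : ∀ j ∈ S ∩ B, ∃ t : 𝕜, 0 < t ∧ t * |ℓ j z| < ℓ j x := by
        intro j hj
        obtain ⟨hjS, hjB⟩ := Finset.mem_inter.1 hj
        have hp := (hS j hjS).1 hjB
        -- The `+ 1` keeps the denominator positive when `ℓ j z = 0` and makes the bound strict.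
        refine ⟨ℓ j x / (|ℓ j z| + 1), by positivity, ?_⟩
        have : 0 < |ℓ j z| + 1 := by positivity
        rw [div_mul_eq_mul_div, div_lt_iff₀ this]
        nlinarith
      choose! t ht0 ht using h1
      obtain ⟨s, hs0, hs⟩ : ∃ s : 𝕜, 0 < s ∧ ∀ j ∈ S ∩ B, s ≤ t j := by
        by_cases hne : (S ∩ B).Nonempty
        · exact ⟨(S ∩ B).inf' hne t, (Finset.lt_inf'_iff hne).2 ht0,
            fun j hj => Finset.inf'_le t hj⟩
        · exact ⟨1, one_pos, fun j hj => absurd ⟨j, hj⟩ hne⟩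
      refine ⟨s, hs0, fun j hj => ⟨fun hjB => ?_, fun hjB => ?_⟩⟩
      · have h := Finset.mem_inter.2 ⟨hj, hjB⟩
        have h2 : s * |ℓ j z| < ℓ j x :=
          lt_of_le_of_lt (mul_le_mul_of_nonneg_right (hs j h) (abs_nonneg _)) (ht j h)
        have h3 : |s * ℓ j z| < ℓ j x := by rwa [abs_mul, abs_of_pos hs0]
        rw [abs_lt] at h3
        simp only [map_add, map_sub, map_smul, smul_eq_mul]
        constructor <;> linarith [h3.1, h3.2]
      · have h2 := (hS j hj).2 hjB
        have h3 := hz0 j (Finset.mem_sdiff.2 ⟨hj, hjB⟩)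
        simp [h2, h3]
    have h0p : IsConeFace (W ⊓ LinearMap.ker (ℓ i)) S ℓ B →
        (∃ x ∈ W, 0 < ℓ i x ∧ ∀ j ∈ S, (j ∈ B → 0 < ℓ j x) ∧ (j ∉ B → ℓ j x = 0)) ∧
        (∃ x ∈ W, ℓ i x < 0 ∧ ∀ j ∈ S, (j ∈ B → 0 < ℓ j x) ∧ (j ∉ B → ℓ j x = 0)) := by
      rintro ⟨x, ⟨hxW, hx0⟩, hS⟩
      obtain ⟨t, ht0, ht⟩ := key x hxW hS
      have hx0 : ℓ i x = 0 := hx0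
      have hplus : x + t • z ∈ W := W.add_mem hxW (W.smul_mem _ hzW)
      have hminus : x - t • z ∈ W := W.sub_mem hxW (W.smul_mem _ hzW)
      have hA : ∀ j ∈ S, (j ∈ B → 0 < ℓ j (x + t • z)) ∧ (j ∉ B → ℓ j (x + t • z) = 0) :=
        fun j hj => ⟨fun h => ((ht j hj).1 h).1, fun h => ((ht j hj).2 h).1⟩
      have hB : ∀ j ∈ S, (j ∈ B → 0 < ℓ j (x - t • z)) ∧ (j ∉ B → ℓ j (x - t • z) = 0) :=
        fun j hj => ⟨fun h => ((ht j hj).1 h).2, fun h => ((ht j hj).2 h).2⟩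
      have e1 : ℓ i (x + t • z) = t * ℓ i z := by simp [hx0]
      have e2 : ℓ i (x - t • z) = -(t * ℓ i z) := by simp [hx0]
      rcases lt_or_gt_of_ne hiz with h | h
      · have := mul_neg_of_pos_of_neg ht0 h
        exact ⟨⟨_, hminus, by rw [e2]; linarith, hB⟩, ⟨_, hplus, by rw [e1]; linarith, hA⟩⟩
      · have := mul_pos ht0 h
        exact ⟨⟨_, hplus, by rw [e1]; linarith, hA⟩, ⟨_, hminus, by rw [e2]; linarith, hB⟩⟩
    have hpm : (∃ x ∈ W, 0 < ℓ i x ∧ ∀ j ∈ S, (j ∈ B → 0 < ℓ j x) ∧ (j ∉ B → ℓ j x = 0)) →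
        (∃ x ∈ W, ℓ i x < 0 ∧ ∀ j ∈ S, (j ∈ B → 0 < ℓ j x) ∧ (j ∉ B → ℓ j x = 0)) →
        IsConeFace (W ⊓ LinearMap.ker (ℓ i)) S ℓ B := by
      rintro ⟨x, hx, hx0, hxS⟩ ⟨y, hy, hy0, hyS⟩
      -- The positive combination of `x` and `y` that lies on the hyperplane; it keeps their common
      -- support on `S`.
      refine ⟨(-ℓ i y) • x + ℓ i x • y, ⟨W.add_mem (W.smul_mem _ hx) (W.smul_mem _ hy), ?_⟩, ?_⟩
      · simp; ring
      · refine fun j hj => ⟨fun h => ?_, fun h => ?_⟩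
        · have h1 := (hxS j hj).1 h
          have h2 := (hyS j hj).1 h
          have := mul_pos (neg_pos.2 hy0) h1
          have := mul_pos hx0 h2
          simp only [map_add, map_smul, smul_eq_mul]
          linarith
        · simp [(hxS j hj).2 h, (hyS j hj).2 h]
    have hface : IsConeFace W S ℓ B ↔ (IsConeFace (W ⊓ LinearMap.ker (ℓ i)) S ℓ B ∨
        (∃ x ∈ W, 0 < ℓ i x ∧ ∀ j ∈ S, (j ∈ B → 0 < ℓ j x) ∧ (j ∉ B → ℓ j x = 0)) ∨
        (∃ x ∈ W, ℓ i x < 0 ∧ ∀ j ∈ S, (j ∈ B → 0 < ℓ j x) ∧ (j ∉ B → ℓ j x = 0))) := by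
      constructor
      · rintro ⟨x, hx, h⟩
        rcases lt_trichotomy (ℓ i x) 0 with h0 | h0 | h0
        · exact Or.inr (Or.inr ⟨x, hx, h0, h⟩)
        · exact Or.inl ⟨x, ⟨hx, h0⟩, h⟩
        · exact Or.inr (Or.inl ⟨x, hx, h0, h⟩)
      · rintro (⟨x, hx, h⟩ | ⟨x, hx, -, h⟩ | ⟨x, hx, -, h⟩)
        exacts [⟨x, hx.1, h⟩, ⟨x, hx, h⟩, ⟨x, hx, h⟩]
    rw [hface]
    generalize IsConeFace (W ⊓ LinearMap.ker (ℓ i)) S ℓ B = p0 at *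
    generalize (∃ x ∈ W, 0 < ℓ i x ∧ ∀ j ∈ S, (j ∈ B → 0 < ℓ j x) ∧ (j ∉ B → ℓ j x = 0)) = pp at *
    generalize (∃ x ∈ W, ℓ i x < 0 ∧ ∀ j ∈ S, (j ∈ B → 0 < ℓ j x) ∧ (j ∉ B → ℓ j x = 0)) = pm at *
    by_cases h0 : p0
    · simp [h0, h0p h0]
    · by_cases h1 : pp <;> by_cases h2 : pm
      · exact absurd (hpm h1 h2) h0
      all_goals simp [h0, h1, h2]
  · push Not at hz
    have h1 : N ⊓ LinearMap.ker (ℓ i) = N := inf_eq_left.2 fun x hx => hz x hx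
    have h2 : ¬ ∃ x ∈ W, 0 < ℓ i x ∧ ∀ j ∈ S, (j ∈ B → 0 < ℓ j x) ∧ (j ∉ B → ℓ j x = 0) := by
      rintro ⟨x, hx, h, hS⟩
      exact h.ne' (hz x (hmemN x hx hS))
    have h3 : ¬ ∃ x ∈ W, ℓ i x < 0 ∧ ∀ j ∈ S, (j ∈ B → 0 < ℓ j x) ∧ (j ∉ B → ℓ j x = 0) := by
      rintro ⟨x, hx, h, hS⟩
      exact h.ne (hz x (hmemN x hx hS))
    have h4 : IsConeFace W S ℓ B ↔ IsConeFace (W ⊓ LinearMap.ker (ℓ i)) S ℓ B := by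
      constructor
      · rintro ⟨x, hx, h⟩
        exact ⟨x, ⟨hx, hz x (hmemN x hx h)⟩, h⟩
      · rintro ⟨x, hx, h⟩
        exact ⟨x, hx.1, h⟩
    rw [if_neg h2, if_neg h3, h1, h4]
    ring

end ConeEuler

/-! ### Euler's relation for polyhedral cones. -/

section ConeEulerRelation

set_option linter.unusedSectionVars false

variable {𝕜 M ι : Type*} [Field 𝕜] [LinearOrder 𝕜] [IsStrictOrderedRing 𝕜]
  [AddCommGroup M] [Module 𝕜 M] [DecidableEq ι]
  {W : Submodule 𝕜 M} {S : Finset ι} {ℓ : ι → M →ₗ[𝕜] 𝕜} {i : ι}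

theorem IsProperCone.insert_of_inf_ker (h : IsProperCone (W ⊓ LinearMap.ker (ℓ i)) S ℓ) :
    IsProperCone W (insert i S) ℓ := by
  obtain ⟨x, ⟨hxW, hx0⟩, hx, j, hj, hjx⟩ := h
  have hx0 : ℓ i x = 0 := hx0
  exact ⟨x, hxW, Finset.forall_mem_insert _ _ _ |>.2 ⟨hx0.ge, hx⟩, j, Finset.mem_insert_of_mem hj,
    hjx⟩

theorem isProperCone_insert_iff :
    IsProperCone W (insert i S) ℓ ↔
      ∃ x ∈ W, 0 ≤ ℓ i x ∧ (∀ j ∈ S, 0 ≤ ℓ j x) ∧ (ℓ i x ≠ 0 ∨ ∃ j ∈ S, ℓ j x ≠ 0) := by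
  simp only [IsProperCone, Finset.forall_mem_insert, Finset.exists_mem_insert, and_assoc]

theorem isProperCone_insert_flipSign_iff (hi : i ∉ S) :
    IsProperCone W (insert i S) (flipSign ℓ i) ↔
      ∃ x ∈ W, ℓ i x ≤ 0 ∧ (∀ j ∈ S, 0 ≤ ℓ j x) ∧ (ℓ i x ≠ 0 ∨ ∃ j ∈ S, ℓ j x ≠ 0) := by
  rw [isProperCone_insert_iff]
  refine exists_congr fun x => and_congr_right fun _ => and_congr (by simp [flipSign_self])
    (and_congr (forall₂_congr fun j hj => by rw [flipSign_of_mem hi j hj]) (or_congr ?_ ?_))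
  · rw [Ne, flipSign_eq_zero_iff]
  · simp only [Ne, flipSign_eq_zero_iff]

/-- If `ℓ i` is nonzero on the lineality space, both half cones are proper, while the cone and its
section are proper together and their lineality dimensions differ by one, so the right side cancels.
Otherwise all four lineality spaces agree, the cone is proper iff one of the halves is, and the
section is proper iff both are. -/
theorem coneEulerChar_add_flipSign [FiniteDimensional 𝕜 M] (hi : i ∉ S) :
    coneEulerChar W (insert i S) ℓ + coneEulerChar W (insert i S) (flipSign ℓ i) =
      coneEulerChar W S ℓ + coneEulerChar (W ⊓ LinearMap.ker (ℓ i)) S ℓ := by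
  classical
  unfold coneEulerChar
  rw [infKer_congr (ℓ := flipSign ℓ i) (ℓ' := ℓ) fun j _ x => flipSign_eq_zero_iff j x,
    infKer_insert, infKer_inf_ker]
  have h0p : IsProperCone (W ⊓ LinearMap.ker (ℓ i)) S ℓ → IsProperCone W (insert i S) ℓ :=
    IsProperCone.insert_of_inf_ker
  have h0m : IsProperCone (W ⊓ LinearMap.ker (ℓ i)) S ℓ →
      IsProperCone W (insert i S) (flipSign ℓ i) := by
    rintro ⟨x, ⟨hxW, hx0⟩, hx, hne⟩
    have hx0 : ℓ i x = 0 := hx0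
    exact (isProperCone_insert_flipSign_iff hi).2 ⟨x, hxW, hx0.le, hx, Or.inr hne⟩
  have h0 : IsProperCone (W ⊓ LinearMap.ker (ℓ i)) S ℓ → IsProperCone W S ℓ :=
    fun ⟨x, hx, h⟩ => ⟨x, hx.1, h⟩
  by_cases hz : ∃ x ∈ infKer W S ℓ, ℓ i x ≠ 0
  · rw [neg_one_pow_finrank_inf_ker _ (ℓ i) hz]
    obtain ⟨z, hz, hiz⟩ := hz
    obtain ⟨hzW, hz0⟩ := mem_infKer.1 hz
    have hn : ∀ j ∈ S, 0 ≤ ℓ j z := fun j hj => (hz0 j hj).ge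
    have hn' : ∀ j ∈ S, 0 ≤ ℓ j (-z) := fun j hj => by simp [hz0 j hj]
    have hp : IsProperCone W (insert i S) ℓ := by
      rw [isProperCone_insert_iff]
      rcases le_total 0 (ℓ i z) with h | h
      · exact ⟨z, hzW, h, hn, Or.inl hiz⟩
      · exact ⟨-z, W.neg_mem hzW, by simpa using h, hn', Or.inl (by simpa using hiz)⟩
    have hm : IsProperCone W (insert i S) (flipSign ℓ i) := by
      rw [isProperCone_insert_flipSign_iff hi]
      rcases le_total 0 (ℓ i z) with h | h
      · exact ⟨-z, W.neg_mem hzW, by simpa using h, hn', Or.inl (by simpa using hiz)⟩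
      · exact ⟨z, hzW, h, hn, Or.inl hiz⟩
    have h1 : IsProperCone W S ℓ → IsProperCone (W ⊓ LinearMap.ker (ℓ i)) S ℓ := by
      rintro ⟨x, hxW, hx, j, hj, hjx⟩
      -- Projection to the hyperplane along the lineality direction `z`, which leaves every `ℓ k`,
      -- `k ∈ S`, unchanged.
      refine ⟨x - (ℓ i x / ℓ i z) • z, ⟨W.sub_mem hxW (W.smul_mem _ hzW), ?_⟩, fun k hk => ?_,
        j, hj, ?_⟩
      · simp [hiz]
      · simpa [hz0 k hk] using hx k hk
      · simpa [hz0 j hj] using hjx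
    rw [if_pos hp, if_pos hm]
    by_cases h : IsProperCone (W ⊓ LinearMap.ker (ℓ i)) S ℓ
    · simp [h, h0 h]
    · simp [h, mt h1 h]
  · push Not at hz
    have h1 : infKer W S ℓ ⊓ LinearMap.ker (ℓ i) = infKer W S ℓ :=
      inf_eq_left.2 fun x hx => hz x hx
    rw [h1]
    have hS : ∀ x ∈ W, (ℓ i x ≠ 0 ∨ ∃ j ∈ S, ℓ j x ≠ 0) → ∃ j ∈ S, ℓ j x ≠ 0 := by
      rintro x hx (h | h)
      · by_contra hc
        push Not at hc
        exact h (hz x (mem_infKer.2 ⟨hx, hc⟩))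
      · exact h
    have hor : IsProperCone W S ℓ ↔
        (IsProperCone W (insert i S) ℓ ∨ IsProperCone W (insert i S) (flipSign ℓ i)) := by
      rw [isProperCone_insert_flipSign_iff hi, isProperCone_insert_iff]
      constructor
      · rintro ⟨x, hxW, hx, hne⟩
        rcases le_total 0 (ℓ i x) with h | h
        · exact Or.inl ⟨x, hxW, h, hx, Or.inr hne⟩
        · exact Or.inr ⟨x, hxW, h, hx, Or.inr hne⟩
      · rintro (⟨x, hxW, -, hx, hne⟩ | ⟨x, hxW, -, hx, hne⟩)
        · exact ⟨x, hxW, hx, hS x hxW hne⟩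
        · exact ⟨x, hxW, hx, hS x hxW hne⟩
    have hand : IsProperCone W (insert i S) ℓ → IsProperCone W (insert i S) (flipSign ℓ i) →
        IsProperCone (W ⊓ LinearMap.ker (ℓ i)) S ℓ := by
      rw [isProperCone_insert_flipSign_iff hi, isProperCone_insert_iff]
      rintro ⟨x, hxW, hx0, hx, hxne⟩ ⟨y, hyW, hy0, hy, hyne⟩
      obtain ⟨j, hj, hjx⟩ := hS x hxW hxne
      rcases hx0.eq_or_lt with hx0 | hx0
      · exact ⟨x, ⟨hxW, hx0.symm⟩, hx, j, hj, hjx⟩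
      rcases hy0.eq_or_lt with hy0 | hy0
      · exact ⟨y, ⟨hyW, hy0⟩, hy, hS y hyW hyne⟩
      have hy0' : 0 < -ℓ i y := neg_pos.2 hy0
      refine ⟨(-ℓ i y) • x + ℓ i x • y, ⟨W.add_mem (W.smul_mem _ hxW) (W.smul_mem _ hyW), ?_⟩,
        fun k hk => ?_, j, hj, ?_⟩
      · simp; ring
      · have h1 := mul_nonneg hy0'.le (hx k hk)
        have h2 := mul_nonneg hx0.le (hy k hk)
        simp only [map_add, map_smul, smul_eq_mul]
        linarith
      · have h1 := mul_pos hy0' (lt_of_le_of_ne (hx j hj) hjx.symm)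
        have h2 := mul_nonneg hx0.le (hy j hj)
        simp only [map_add, map_smul, smul_eq_mul]
        linarith
    rw [hor]
    by_cases h : IsProperCone (W ⊓ LinearMap.ker (ℓ i)) S ℓ
    · simp [h, h0p h, h0m h]
    · by_cases hp : IsProperCone W (insert i S) ℓ <;>
        by_cases hm : IsProperCone W (insert i S) (flipSign ℓ i)
      · exact absurd (hand hp hm) h
      all_goals simp [h, hp, hm]

theorem coneEulerSum_insert_of_forall_eq_zero (hi : i ∉ S)
    (h : ∀ x ∈ W, (∀ j ∈ insert i S, 0 ≤ ℓ j x) → ℓ i x = 0) :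
    coneEulerSum W (insert i S) ℓ = coneEulerSum (W ⊓ LinearMap.ker (ℓ i)) S ℓ := by
  classical
  rw [coneEulerSum_insert hi, add_eq_left]
  refine Finset.sum_eq_zero fun B _ => if_neg ?_
  rintro ⟨x, hxW, hx0, hx⟩
  refine hx0.ne' (h x hxW ((Finset.forall_mem_insert _ _ _).2 ⟨hx0.le, fun j hj => ?_⟩))
  by_cases hB : j ∈ B
  · exact ((hx j hj).1 hB).le
  · exact ((hx j hj).2 hB).ge

theorem coneEulerChar_insert_of_forall_eq_zero
    (h : ∀ x ∈ W, (∀ j ∈ insert i S, 0 ≤ ℓ j x) → ℓ i x = 0) :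
    coneEulerChar W (insert i S) ℓ = coneEulerChar (W ⊓ LinearMap.ker (ℓ i)) S ℓ := by
  have h1 : IsProperCone W (insert i S) ℓ ↔ IsProperCone (W ⊓ LinearMap.ker (ℓ i)) S ℓ := by
    refine ⟨?_, IsProperCone.insert_of_inf_ker⟩
    rintro ⟨x, hxW, hx, j, hj, hjx⟩
    have h0 := h x hxW hx
    refine ⟨x, ⟨hxW, h0⟩, fun k hk => hx k (Finset.mem_insert_of_mem hk), j, ?_, hjx⟩
    exact (Finset.mem_insert.1 hj).resolve_left fun hji => hjx (hji ▸ h0)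
  unfold coneEulerChar
  rw [h1, infKer_insert, infKer_inf_ker]

/-- If the functionals are independent on `W`, then every set of functionals is a face. -/
theorem coneEulerSum_eq_of_surjective [FiniteDimensional 𝕜 M] (hi : i ∉ S)
    (IH : ∀ W : Submodule 𝕜 M, coneEulerSum W S ℓ = coneEulerChar W S ℓ)
    (hsurj : ∀ f : ι → 𝕜, ∃ x ∈ W, ∀ j ∈ insert i S, ℓ j x = f j) :
    coneEulerSum W (insert i S) ℓ = coneEulerChar W (insert i S) ℓ := by
  classical
  have hsurj' : ∀ f : ι → 𝕜, ∃ x ∈ W, ∀ j ∈ insert i S, flipSign ℓ i j x = f j := by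
    intro f
    obtain ⟨x, hxW, hx⟩ := hsurj (Function.update f i (-f i))
    refine ⟨x, hxW, fun j hj => ?_⟩
    by_cases hji : j = i
    · subst hji; simp [flipSign_self, hx j hj]
    · simp [flipSign_of_ne hji, hx j hj, hji]
  have hface : ∀ ℓ' : ι → M →ₗ[𝕜] 𝕜, (∀ f : ι → 𝕜, ∃ x ∈ W, ∀ j ∈ insert i S, ℓ' j x = f j) →
      (∀ B, IsConeFace W (insert i S) ℓ' B) ∧ IsProperCone W (insert i S) ℓ' := by
    intro ℓ' h
    refine ⟨fun B => ?_, ?_⟩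
    · obtain ⟨x, hxW, hx⟩ := h fun j => if j ∈ B then 1 else 0
      exact ⟨x, hxW, fun j hj => ⟨fun hB => by simp [hx j hj, hB], fun hB => by simp [hx j hj, hB]⟩⟩
    · obtain ⟨x, hxW, hx⟩ := h fun _ => 1
      exact ⟨x, hxW, fun j hj => by simp [hx j hj], i, Finset.mem_insert_self _ _,
        by simp [hx i (Finset.mem_insert_self _ _)]⟩
  -- All supports occur on both sides of the hyperplane, so the half cones have equal sums; the cut
  -- identity then says that twice this sum is `0`.
  have h1 : coneEulerSum W (insert i S) ℓ = coneEulerSum W (insert i S) (flipSign ℓ i) := by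
    unfold coneEulerSum
    refine Finset.sum_congr rfl fun B _ => ?_
    rw [if_pos ((hface ℓ hsurj).1 B), if_pos ((hface _ hsurj').1 B),
      infKer_congr (ℓ := flipSign ℓ i) (ℓ' := ℓ) fun j _ x => flipSign_eq_zero_iff j x]
  have h2 := coneEulerSum_add_flipSign (W := W) (ℓ := ℓ) hi
  rw [IH, IH, ← coneEulerChar_add_flipSign hi, ← h1] at h2
  have h3 : coneEulerChar W (insert i S) ℓ = 0 := if_pos (hface ℓ hsurj).2
  have h4 : coneEulerChar W (insert i S) (flipSign ℓ i) = 0 := if_pos (hface _ hsurj').2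
  omega

/-- A family of functionals that is not surjective on `W` satisfies a linear relation there. -/
theorem exists_relation_of_not_surjective
    (h : ¬ ∀ f : ι → 𝕜, ∃ x ∈ W, ∀ j ∈ S, ℓ j x = f j) :
    ∃ a : ι → 𝕜, (∃ i ∈ S, a i ≠ 0) ∧ ∀ x ∈ W, ∑ j ∈ S, a j * ℓ j x = 0 := by
  classical
  let φ : W →ₗ[𝕜] (S → 𝕜) := LinearMap.pi fun j => (ℓ j).domRestrict W
  have hlt : LinearMap.range φ < ⊤ := by
    rw [lt_top_iff_ne_top]
    intro htop
    refine h fun f => ?_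
    obtain ⟨x, hx⟩ := LinearMap.range_eq_top.1 htop fun j => f j
    exact ⟨x, x.2, fun j hj => congrFun hx ⟨j, hj⟩⟩
  -- The coefficients of the relation are the coordinates of a nonzero functional that kills the
  -- range.
  obtain ⟨g, hg0, hg⟩ := Submodule.exists_le_ker_of_lt_top _ hlt
  have hgsum : ∀ v : S → 𝕜, g v = ∑ j, v j * g (Pi.single j 1) := by
    intro v
    conv_lhs => rw [← Finset.univ_sum_single v]
    rw [map_sum]
    refine Finset.sum_congr rfl fun j _ => ?_
    rw [← smul_eq_mul, ← map_smul, ← Pi.single_smul, smul_eq_mul, mul_one]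
  refine ⟨fun j => if hj : j ∈ S then g (Pi.single ⟨j, hj⟩ 1) else 0, ?_, fun x hx => ?_⟩
  · by_contra hc
    push Not at hc
    refine hg0 (LinearMap.ext fun v => ?_)
    rw [hgsum]
    refine Finset.sum_eq_zero fun j _ => ?_
    have := hc j j.2
    simp only [j.2, dif_pos] at this
    rw [this, mul_zero]
  · have h1 : g (φ ⟨x, hx⟩) = 0 := hg ⟨_, rfl⟩
    rw [hgsum] at h1
    rw [← Finset.sum_coe_sort, ← h1]
    refine Finset.sum_congr rfl fun j _ => ?_
    simp [φ, mul_comm]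

/-- **Euler's relation** for polyhedral cones. -/
theorem coneEulerSum_eq_coneEulerChar [FiniteDimensional 𝕜 M] (W : Submodule 𝕜 M) (S : Finset ι)
    (ℓ : ι → M →ₗ[𝕜] 𝕜) : coneEulerSum W S ℓ = coneEulerChar W S ℓ := by
  classical
  induction S using Finset.strongInduction generalizing W ℓ with
  | H S IH =>
  have IH' : ∀ i ∈ S, ∃ T, i ∉ T ∧ insert i T = S ∧
      ∀ (W : Submodule 𝕜 M) (ℓ : ι → M →ₗ[𝕜] 𝕜), coneEulerSum W T ℓ = coneEulerChar W T ℓ :=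
    fun i hi => ⟨S.erase i, Finset.notMem_erase i S, Finset.insert_erase hi,
      IH _ (Finset.erase_ssubset hi)⟩
  rcases S.eq_empty_or_nonempty with rfl | ⟨i, hi⟩
  · have h1 : IsConeFace W ∅ ℓ ∅ := ⟨0, W.zero_mem, by simp⟩
    have h2 : ¬ IsProperCone W ∅ ℓ := by simp [IsProperCone]
    rw [coneEulerSum, coneEulerChar, if_neg h2, Finset.powerset_empty, Finset.sum_singleton,
      if_pos h1, Finset.empty_sdiff]
  by_cases hsurj : ∀ f : ι → 𝕜, ∃ x ∈ W, ∀ j ∈ S, ℓ j x = f j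
  · obtain ⟨T, hiT, rfl, hT⟩ := IH' i hi
    exact coneEulerSum_eq_of_surjective hiT (fun W => hT W ℓ) hsurj
  obtain ⟨a, ⟨k, hk, hak⟩, ha⟩ := exists_relation_of_not_surjective hsurj
  -- reversing signs does not affect the truth of the statement
  have hflip : ∀ F : Finset ι, F ⊆ S →
      coneEulerSum W S (fun j => if j ∈ F then -ℓ j else ℓ j) =
        coneEulerChar W S (fun j => if j ∈ F then -ℓ j else ℓ j) →
      coneEulerSum W S ℓ = coneEulerChar W S ℓ := by
    intro F
    induction F using Finset.induction_on with
    | empty => simp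
    | insert j F hj ihF =>
      intro hF h
      have hjS := hF (Finset.mem_insert_self j F)
      refine ihF (fun x hx => hF (Finset.mem_insert_of_mem hx)) ?_
      have hfl : (fun m => if m ∈ insert j F then -ℓ m else ℓ m) =
          flipSign (fun m => if m ∈ F then -ℓ m else ℓ m) j := by
        funext m
        by_cases hm : m = j
        · subst hm; simp [flipSign_self, hj]
        · rw [flipSign_of_ne hm]; simp [hm]
      rw [hfl] at h
      obtain ⟨T, hjT, rfl, hT⟩ := IH' j hjS
      have h1 := coneEulerSum_add_flipSign (W := W)
        (ℓ := fun m => if m ∈ F then -ℓ m else ℓ m) hjT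
      rw [hT, hT, ← coneEulerChar_add_flipSign hjT, h] at h1
      exact add_right_cancel h1
  -- After these reversals the relation has coefficients `|a j|`. On the cone it is a vanishing sum
  -- of nonnegative terms, so `ℓ' k = 0` there and the inequality `k` can be replaced by restriction
  -- to a hyperplane.
  refine hflip (S.filter fun j => a j < 0) (Finset.filter_subset _ _) ?_
  set ℓ' : ι → M →ₗ[𝕜] 𝕜 := fun j => if j ∈ S.filter (fun j => a j < 0) then -ℓ j else ℓ j
    with hℓ'
  have habs : ∀ j ∈ S, ∀ x, a j * ℓ j x = |a j| * ℓ' j x := by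
    intro j hj x
    by_cases h : a j < 0
    · simp [hℓ', h, hj, abs_of_neg]
    · simp [hℓ', h, abs_of_nonneg (not_lt.1 h)]
  obtain ⟨T, hkT, rfl, hT⟩ := IH' k hk
  have hdeg : ∀ x ∈ W, (∀ j ∈ insert k T, 0 ≤ ℓ' j x) → ℓ' k x = 0 := by
    intro x hxW hx
    have h1 := ha x hxW
    rw [Finset.sum_congr rfl fun j hj => habs j hj x, Finset.sum_eq_zero_iff_of_nonneg
      fun j hj => mul_nonneg (abs_nonneg _) (hx j hj)] at h1
    exact (mul_eq_zero.1 (h1 k hk)).resolve_left (abs_ne_zero.2 hak)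
  rw [coneEulerSum_insert_of_forall_eq_zero hkT hdeg,
    coneEulerChar_insert_of_forall_eq_zero hdeg, hT]

end ConeEulerRelation

/-! ### Totally cyclic arc sets as unions of directed cycles. -/

namespace MultiDigraph

variable {V A : Type*}

theorem isTotallyCyclic_restrict_iff (D : MultiDigraph V A) (B : Set A) :
    (D.restrict B).IsTotallyCyclic ↔
      ∀ a ∈ B, (D.restrict B).Reachable (D.head a) (D.tail a) := by
  constructor
  · intro h a ha
    exact (h _ _ (Relation.EqvGen.rel _ _ ⟨⟨a, ha⟩, rfl, rfl⟩)).2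
  · intro h u v huv
    induction huv with
    | rel x y hxy =>
      obtain ⟨⟨a, ha⟩, rfl, rfl⟩ := hxy
      exact ⟨Relation.ReflTransGen.single ⟨⟨a, ha⟩, rfl, rfl⟩, h a ha⟩
    | refl x => exact ⟨Relation.ReflTransGen.refl, Relation.ReflTransGen.refl⟩
    | symm x y _ ih => exact ih.symm
    | trans x y z _ _ ih1 ih2 => exact ⟨ih1.1.trans ih2.1, ih2.2.trans ih1.2⟩

/-- Walks are indexed by all of `ℕ`, with irrelevant values beyond `n`, so that they can be cut and
spliced without dependent types. -/
theorem exists_walk_of_reachable (D : MultiDigraph V A) {B : Set A} {a : A} (ha : a ∈ B) {w : V}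
    (h : (D.restrict B).Reachable (D.head a) w) :
    ∃ (n : ℕ) (f : ℕ → A), f 0 = a ∧ (∀ i, f i ∈ B) ∧
      (∀ i < n, D.head (f i) = D.tail (f (i + 1))) ∧ D.head (f n) = w := by
  induction h with
  | refl => exact ⟨0, fun _ => a, rfl, fun _ => ha, by simp, rfl⟩
  | tail _ hbc ih =>
    obtain ⟨n, f, hf0, hfB, hf, hfn⟩ := ih
    obtain ⟨⟨b, hb⟩, hbt, rfl⟩ := hbc
    refine ⟨n + 1, fun k => if k ≤ n then f k else b, by simp [hf0], fun i => ?_, fun i hi => ?_, ?_⟩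
    · dsimp only
      split_ifs
      exacts [hfB i, hb]
    · rcases (Nat.lt_succ_iff.1 hi).eq_or_lt with rfl | h
      · have hbt : D.tail b = D.head (f i) := hbt.trans hfn.symm
        simp [hbt]
      · have h1 : i ≤ n := h.le
        have h2 : i + 1 ≤ n := h
        simp only [h1, h2, if_true, hf i h]
    · simp [restrict]

/-- A shortest closed walk with first arc `a` repeats no vertex. -/
theorem exists_isDirectedCycle (D : MultiDigraph V A) {B : Set A} {a : A} (ha : a ∈ B)
    (h : (D.restrict B).Reachable (D.head a) (D.tail a)) :
    ∃ C ⊆ B, a ∈ C ∧ D.IsDirectedCycle C := by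
  classical
  have hex := D.exists_walk_of_reachable ha h
  obtain ⟨f, hf0, hfB, hf, hfn⟩ := Nat.find_spec hex
  have hmin := fun m (hm : m < Nat.find hex) => Nat.find_min hex hm
  set n := Nat.find hex
  have hinj : ∀ i j, i < j → j ≤ n → D.tail (f i) ≠ D.tail (f j) := by
    intro i j hij hjn heq
    rcases Nat.eq_zero_or_pos i with rfl | hi
    -- Back at the tail of `a` the walk can stop; a later repetition is handled by excising the arcs
    -- `i, …, j - 1`, which keeps the first arc.
    · refine hmin (j - 1) (by omega) ⟨f, hf0, hfB, fun k hk => hf k (by omega), ?_⟩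
      rw [hf (j - 1) (by omega), Nat.sub_add_cancel hij, ← heq, hf0]
    · refine hmin (n - (j - i)) (by omega)
        ⟨fun k => if k < i then f k else f (k + (j - i)), by simp [hi, hf0], fun k => ?_,
          fun k hk => ?_, ?_⟩
      · dsimp only
        split_ifs
        exacts [hfB _, hfB _]
      · dsimp only
        by_cases h1 : k + 1 < i
        · rw [if_pos (by omega), if_pos h1, hf k (by omega)]
        · by_cases h2 : k < i
          · have h3 : k + 1 = i := by omega
            rw [if_pos h2, if_neg h1, h3, show i + (j - i) = j by omega, ← heq, ← h3,
              hf k (by omega)]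
          · rw [if_neg h2, if_neg h1, hf _ (by omega), show k + (j - i) + 1 = k + 1 + (j - i) by omega]
      · dsimp only
        rw [if_neg (by omega), show n - (j - i) + (j - i) = n by omega, hfn]
  refine ⟨Set.range fun i : Fin (n + 1) => f i, ?_, ⟨0, hf0⟩, n, fun i => f i, ?_, ?_, rfl⟩
  · rintro _ ⟨i, rfl⟩
    exact hfB i
  · intro i j hij
    dsimp only at hij
    by_contra hne
    rcases lt_or_gt_of_ne (fun h => hne (Fin.ext h) : (i : ℕ) ≠ j) with h | h
    · exact hinj i j h (by omega) hij
    · exact hinj j i h (by omega) hij.symm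
  · intro i
    dsimp only
    rw [Fin.val_add_one]
    split_ifs with hi
    · rw [hi, hf0]; exact hfn
    · have : (i : ℕ) ≠ n := fun h => hi (Fin.ext h)
      exact hf i (by omega)

theorem isCycleUnion_of_isTotallyCyclic [Finite A] (D : MultiDigraph V A) {B : Set A}
    (h : (D.restrict B).IsTotallyCyclic) : D.IsCycleUnion B := by
  rw [isTotallyCyclic_restrict_iff] at h
  choose! C hCB haC hC using fun a ha => D.exists_isDirectedCycle ha (h a ha)
  obtain ⟨r, ⟨e⟩⟩ := Finite.exists_equiv_fin B
  refine ⟨r, fun i => C (e.symm i), fun i => hC _ (e.symm i).2, Set.Subset.antisymm ?_ ?_⟩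
  · intro a ha
    refine Set.mem_iUnion.2 ⟨e ⟨a, ha⟩, ?_⟩
    simpa using haC a ha
  · exact Set.iUnion_subset fun i => hCB _ (e.symm i).2

/-! ### Nonnegative circulations and their supports. -/

/-- The space of circulations of `D` that are supported in `B`. -/
noncomputable def circulations [Fintype A] (D : MultiDigraph V A) (B : Set A) : Submodule ℚ (A → ℚ) :=
  LinearMap.ker D.incidenceMatrix.mulVecLin ⊓
    { carrier := {x | ∀ a ∉ B, x a = 0}
      add_mem' := fun hx hy a ha => by simp [hx a ha, hy a ha]
      zero_mem' := fun a _ => rfl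
      smul_mem' := fun c x hx a ha => by simp [hx a ha] }

/-- `B` is the support of a nonnegative circulation. -/
def IsCirculationSupport [Fintype A] (D : MultiDigraph V A) (B : Set A) : Prop :=
  ∃ x ∈ D.circulations B, ∀ a ∈ B, 0 < x a

variable [Fintype A] (D : MultiDigraph V A) {B : Set A}

open Classical in
theorem mem_circulations {x : A → ℚ} :
    x ∈ D.circulations B ↔ (∀ v, ∑ a, ((if D.head a = v then 1 else 0) -
      (if D.tail a = v then 1 else 0)) * x a = 0) ∧ ∀ a ∉ B, x a = 0 := by
  simp only [circulations, Submodule.mem_inf, LinearMap.mem_ker, Matrix.mulVecLin_apply,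
    funext_iff, Matrix.mulVec, dotProduct, incidenceMatrix, Matrix.of_apply, Pi.zero_apply]
  rfl

theorem circulations_mono {B B' : Set A} (h : B ⊆ B') : D.circulations B ≤ D.circulations B' :=
  fun _ hx => (D.mem_circulations).2 ⟨((D.mem_circulations).1 hx).1,
    fun a ha => ((D.mem_circulations).1 hx).2 a fun hB => ha (h hB)⟩

theorem mem_circulations_of_forall_notMem {B B' : Set A} {x : A → ℚ} (hx : x ∈ D.circulations B')
    (h : ∀ a ∉ B, x a = 0) : x ∈ D.circulations B :=
  (D.mem_circulations).2 ⟨((D.mem_circulations).1 hx).1, h⟩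

/-- Circulations are orthogonal to potential differences: weight the conservation law at `v` by `g
v` and sum. -/
theorem sum_sub_mul_eq_zero [Fintype V] {x : A → ℚ} (hx : x ∈ D.circulations B) (g : V → ℚ) :
    ∑ a, (g (D.head a) - g (D.tail a)) * x a = 0 := by
  classical
  have h := ((D.mem_circulations).1 hx).1
  have h1 : ∑ v, g v * ∑ a, ((if D.head a = v then 1 else 0) -
      (if D.tail a = v then 1 else 0)) * x a = 0 :=
    Finset.sum_eq_zero fun v _ => by
      have := h v
      rw [mul_eq_zero]; right; convert this
  rw [← h1]
  simp only [Finset.mul_sum]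
  rw [Finset.sum_comm]
  refine Finset.sum_congr rfl fun a _ => ?_
  simp only [← mul_assoc, ← Finset.sum_mul, mul_sub, Finset.sum_sub_distrib]
  simp

theorem IsCirculationSupport.isTotallyCyclic [Fintype V] (h : D.IsCirculationSupport B) :
    (D.restrict B).IsTotallyCyclic := by
  classical
  obtain ⟨x, hx, hpos⟩ := h
  rw [isTotallyCyclic_restrict_iff]
  intro a ha
  have hx0 := ((D.mem_circulations).1 hx).2
  -- The potential is the indicator of the set reachable from the head of `a`. No arc of `B` leaves
  -- this set, so all terms are nonnegative and hence zero; `a` would contribute a positive term if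
  -- its tail were outside.
  have h1 := D.sum_sub_mul_eq_zero hx
    fun v => if (D.restrict B).Reachable (D.head a) v then 1 else 0
  have hnn : ∀ b ∈ Finset.univ, (0 : ℚ) ≤
      ((if (D.restrict B).Reachable (D.head a) (D.head b) then 1 else 0) -
        (if (D.restrict B).Reachable (D.head a) (D.tail b) then 1 else 0)) * x b := by
    intro b _
    by_cases hb : b ∈ B
    · refine mul_nonneg ?_ (hpos b hb).le
      by_cases hr : (D.restrict B).Reachable (D.head a) (D.tail b)
      · have : (D.restrict B).Reachable (D.head a) (D.head b) := hr.tail ⟨⟨b, hb⟩, rfl, rfl⟩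
        simp [hr, this]
      · simp only [hr, if_false, sub_zero]
        split_ifs <;> norm_num
    · simp [hx0 b hb]
  rw [Finset.sum_eq_zero_iff_of_nonneg hnn] at h1
  have h2 := (mul_eq_zero.1 (h1 a (Finset.mem_univ a))).resolve_right (hpos a ha).ne'
  by_contra hr
  have hr0 : (D.restrict B).Reachable (D.head a) (D.head a) := Relation.ReflTransGen.refl
  simp [hr, hr0] at h2

theorem IsDirectedCycle.isCirculationSupport {C : Set A} (h : D.IsDirectedCycle C) :
    D.IsCirculationSupport C := by
  classical
  obtain ⟨n, a, hinj, hnext, rfl⟩ := h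
  have hinj' : Function.Injective a := fun i j hij => hinj (by simp [hij])
  refine ⟨fun b => if b ∈ Set.range a then 1 else 0, (D.mem_circulations).2 ⟨fun v => ?_, ?_⟩, ?_⟩
  · have h1 : ∀ g : A → ℚ, ∑ b, g b * (if b ∈ Set.range a then 1 else 0) = ∑ i, g (a i) := by
      intro g
      simp only [mul_ite, mul_one, mul_zero]
      rw [← Finset.sum_filter, ← Finset.sum_image (f := g) (g := a) fun i _ j _ h => hinj' h]
      refine Finset.sum_congr ?_ fun _ _ => rfl
      ext b; simp
    rw [h1, Finset.sum_sub_distrib, sub_eq_zero]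
    simp only [hnext]
    -- Inflow at `v` is outflow at `v` with the cyclic index shifted by one.
    exact Equiv.sum_comp (Equiv.addRight (1 : Fin (n + 1)))
      fun i => if D.tail (a i) = v then (1 : ℚ) else 0
  · intro b hb
    simp only [hb, if_false]
  · intro b hb
    simp only [hb, if_true, one_pos]

theorem IsCycleUnion.isCirculationSupport {C : Set A} (h : D.IsCycleUnion C) :
    D.IsCirculationSupport C := by
  obtain ⟨r, S, hS, rfl⟩ := h
  choose x hx hpos using fun i => (hS i).isCirculationSupport
  refine ⟨∑ i, x i, Submodule.sum_mem _ fun i _ =>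
    D.circulations_mono (Set.subset_iUnion S i) (hx i), fun a ha => ?_⟩
  obtain ⟨i, hi⟩ := Set.mem_iUnion.1 ha
  rw [Finset.sum_apply]
  refine Finset.sum_pos' (fun j _ => ?_) ⟨i, Finset.mem_univ i, hpos i a hi⟩
  by_cases hj : a ∈ S j
  · exact (hpos j a hj).le
  · exact (((D.mem_circulations).1 (hx j)).2 a hj).ge

theorem isTotallyCyclic_iff_isCirculationSupport [Fintype V] :
    (D.restrict B).IsTotallyCyclic ↔ D.IsCirculationSupport B :=
  ⟨fun h => (D.isCycleUnion_of_isTotallyCyclic h).isCirculationSupport,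
    fun h => h.isTotallyCyclic⟩

theorem isCycleUnion_iff_isTotallyCyclic [Fintype V] :
    D.IsCycleUnion B ↔ (D.restrict B).IsTotallyCyclic :=
  ⟨fun h => h.isCirculationSupport.isTotallyCyclic, D.isCycleUnion_of_isTotallyCyclic⟩

theorem circulations_lt {B B' : Set A} (h : B ⊂ B') (hB' : D.IsCirculationSupport B') :
    D.circulations B < D.circulations B' := by
  obtain ⟨x, hx, hpos⟩ := hB'
  obtain ⟨a, ha, haB⟩ := Set.exists_of_ssubset h
  refine lt_of_le_of_ne (D.circulations_mono h.subset) fun heq => ?_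
  rw [← heq] at hx
  exact (hpos a ha).ne' (((D.mem_circulations).1 hx).2 a haB)

/-- For any arc `a₀` of `B'` outside `B`, the single equation `z a₀ = 0` already cuts `circulations
B'` down to `circulations B`; otherwise a support strictly between the two could be built. -/
theorem finrank_circulations_of_covBy [Fintype V] {B B' : D.TotallyCyclicPoset} (h : B ⋖ B') :
    Module.finrank ℚ (D.circulations B'.1) = Module.finrank ℚ (D.circulations B.1) + 1 := by
  classical
  obtain ⟨x, hx, hxpos⟩ := (D.isTotallyCyclic_iff_isCirculationSupport).1 B'.2
  obtain ⟨y, hy, hypos⟩ := (D.isTotallyCyclic_iff_isCirculationSupport).1 B.2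
  have hx0 := ((D.mem_circulations).1 hx).2
  have hy0 := ((D.mem_circulations).1 hy).2
  have hsub : B.1 ⊂ B'.1 := h.lt
  obtain ⟨a₀, ha₀, ha₀B⟩ := Set.exists_of_ssubset hsub
  -- a circulation on `B'` vanishing at `a₀` is nonpositive outside `B`
  have key : ∀ z ∈ D.circulations B'.1, z a₀ = 0 → ∀ a ∉ B.1, z a ≤ 0 := by
    intro z hz hz0 a₁ ha₁
    by_contra! hza₁
    have hzs := ((D.mem_circulations).1 hz).2
    let P : Finset A := Finset.univ.filter fun a => a ∉ B.1 ∧ 0 < z a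
    have hP : ∀ a, a ∈ P ↔ a ∉ B.1 ∧ 0 < z a := fun a => by simp [P]
    obtain ⟨a₂, ha₂, hmin⟩ := P.exists_min_image (fun a => x a / z a) ⟨a₁, (hP _).2 ⟨ha₁, hza₁⟩⟩
    rw [hP] at ha₂
    have hPB' : ∀ a, 0 < z a → a ∈ B'.1 := fun a h => by
      by_contra hc
      exact h.ne' (hzs a hc)
    -- A ratio test: `t` is the largest step for which `x - t • z` stays nonnegative outside `B`. It
    -- vanishes at `a₂`, while at `a₀` it equals `x a₀ > 0`.
    set t := x a₂ / z a₂ with ht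
    have ht0 : 0 < t := div_pos (hxpos _ (hPB' _ ha₂.2)) ha₂.2
    -- A large multiple of `y` restores positivity on `B` without changing anything outside. Terms
    -- of `N` with `y a = 0` are `0` by the convention for division.
    let u : A → ℚ := x - t • z
    let N : ℚ := ∑ a, |u a| / |y a| + 1
    let w : A → ℚ := u + N • y
    have hw : w ∈ D.circulations B'.1 :=
      Submodule.add_mem _ (Submodule.sub_mem _ hx (Submodule.smul_mem _ _ hz))
        (Submodule.smul_mem _ _ (D.circulations_mono hsub.subset hy))
    have hwB : ∀ a ∈ B.1, 0 < w a := by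
      intro a ha
      have h1 := hypos a ha
      have h2 : |u a| / |y a| ≤ ∑ a, |u a| / |y a| :=
        Finset.single_le_sum (f := fun a => |u a| / |y a|) (fun b _ => by positivity)
          (Finset.mem_univ a)
      have h3 : |u a| + y a ≤ N * y a := by
        have h4 : (|u a| / |y a| + 1) * y a = |u a| + y a := by
          rw [abs_of_pos h1]; field_simp
        rw [← h4]
        exact mul_le_mul_of_nonneg_right (by simp only [N]; linarith) h1.le
      have h5 := neg_abs_le (u a)
      simp only [w, Pi.add_apply, Pi.smul_apply, smul_eq_mul]
      linarith
    have hwu : ∀ a ∉ B.1, w a = x a - t * z a := by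
      intro a ha
      simp [w, u, hy0 a ha]
    have hwnn : ∀ a, 0 ≤ w a := by
      intro a
      by_cases ha : a ∈ B.1
      · exact (hwB a ha).le
      rw [hwu a ha]
      have hxa : 0 ≤ x a := by
        by_cases hb : a ∈ B'.1
        · exact (hxpos a hb).le
        · exact (hx0 a hb).ge
      by_cases hza : 0 < z a
      · have h1 := hmin a ((hP a).2 ⟨ha, hza⟩)
        rw [le_div_iff₀ hza] at h1
        linarith
      · nlinarith
    have hsupp : D.IsCirculationSupport {a | 0 < w a} :=
      ⟨w, D.mem_circulations_of_forall_notMem hw fun a ha =>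
        le_antisymm (not_lt.1 ha) (hwnn a), fun a ha => ha⟩
    let B'' : D.TotallyCyclicPoset := ⟨_, hsupp.isTotallyCyclic⟩
    refine h.2 (c := B'') ?_ ?_
    · refine (Set.ssubset_iff_exists (s := B.1) (t := {a | 0 < w a})).2 ⟨hwB, a₀, ?_, ha₀B⟩
      rw [Set.mem_ofPred_eq, hwu a₀ ha₀B, hz0]
      simpa using hxpos a₀ ha₀
    · refine (Set.ssubset_iff_exists (s := {a | 0 < w a}) (t := B'.1)).2 ⟨fun a ha => ?_, a₂,
        hPB' _ ha₂.2, ?_⟩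
      · by_contra hc
        exact ha.ne' (((D.mem_circulations).1 hw).2 a hc)
      · rw [Set.mem_ofPred_eq, hwu a₂ ha₂.1, ht, div_mul_cancel₀ _ ha₂.2.ne']
        simp
  have hker : D.circulations B.1 =
      D.circulations B'.1 ⊓ LinearMap.ker (LinearMap.proj (R := ℚ) (φ := fun _ : A => ℚ) a₀) := by
    apply le_antisymm
    · exact fun z hz => ⟨D.circulations_mono hsub.subset hz, ((D.mem_circulations).1 hz).2 a₀ ha₀B⟩
    · rintro z ⟨hz, hz0⟩
      have hz0 : z a₀ = 0 := hz0
      refine D.mem_circulations_of_forall_notMem hz fun a ha => le_antisymm (key z hz hz0 a ha) ?_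
      -- The hypotheses on `z` are symmetric under negation, which gives the opposite inequality.
      have := key (-z) (Submodule.neg_mem _ hz) (by simp [hz0]) a ha
      simpa using this
  rw [hker]
  exact (finrank_inf_ker_add_one _ _ ⟨x, hx, (hxpos a₀ ha₀).ne'⟩).symm

end MultiDigraph

/-! ### The rank function and the Möbius function. -/

namespace MultiDigraph

variable {V A : Type*} [Fintype A] (D : MultiDigraph V A)

theorem isCirculationSupport_empty : D.IsCirculationSupport ∅ :=
  ⟨0, Submodule.zero_mem _, by simp⟩

theorem finrank_circulations_empty : Module.finrank ℚ (D.circulations ∅) = 0 := by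
  rw [Submodule.finrank_eq_zero, Submodule.eq_bot_iff]
  exact fun x hx => funext fun a => ((D.mem_circulations).1 hx).2 a (Set.notMem_empty a)

variable [Fintype V]

/-- Strict monotonicity of the dimension bounds the height from above; a lower cover, where the
dimension drops by only one, bounds it from below. -/
theorem height_eq_finrank_circulations (B : D.TotallyCyclicPoset) :
    Order.height B = Module.finrank ℚ (D.circulations B.1) := by
  induction B using WellFoundedLT.induction with
  | ind B ih =>
  apply le_antisymm
  · rw [Order.height_le_coe_iff]
    intro C hC
    rw [ih C hC, Nat.cast_lt]
    exact Submodule.finrank_lt_finrank_of_lt (D.circulations_lt hC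
      ((D.isTotallyCyclic_iff_isCirculationSupport).1 B.2))
  · by_cases hmin : IsMin B
    · have hB : B.1 = ∅ := Set.subset_empty_iff.1 (hmin
        (b := ⟨∅, (D.isCirculationSupport_empty).isTotallyCyclic⟩) (Set.empty_subset B.1))
      rw [hB, finrank_circulations_empty]
      simp
    · obtain ⟨C, hC⟩ := exists_covBy_of_wellFoundedGT hmin
      rw [D.finrank_circulations_of_covBy hC, Nat.cast_add, ← ih C hC.lt]
      exact Order.height_add_one_le hC.lt

theorem rkQ_eq_finrank_circulations (B : D.TotallyCyclicPoset) :
    D.rkQ B = Module.finrank ℚ (D.circulations B.1) := by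
  rw [rkQ, height_eq_finrank_circulations, ENat.toNat_natCast]

theorem isRankFunction_rkQ : IsRankFunction D.rkQ := by
  refine ⟨fun B hB => ?_, fun B B' h => ?_⟩
  · rw [rkQ, Order.height_eq_zero.2 hB, ENat.toNat_zero]
  · rw [rkQ_eq_finrank_circulations, rkQ_eq_finrank_circulations,
      D.finrank_circulations_of_covBy h]

theorem isCycleUnion_iff_isCirculationSupport {C : Set A} :
    D.IsCycleUnion C ↔ D.IsCirculationSupport C :=
  (D.isCycleUnion_iff_isTotallyCyclic).trans D.isTotallyCyclic_iff_isCirculationSupport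

-- Euler's relation for the cone of nonnegative circulations supported in `C`, with the arc
-- coordinates as functionals. Its faces are the cycle unions inside `C`, and it is proper because
-- `C` is nonempty.
open Classical in
theorem sum_neg_one_pow_finrank_circulations {C : D.CyclePoset} (hC : C.1.Nonempty) :
    ∑ Y : D.CyclePoset with Y ≤ C, (-1 : ℤ) ^ Module.finrank ℚ (D.circulations Y.1) = 0 := by
  let ℓ : A → (A → ℚ) →ₗ[ℚ] ℚ := fun a => LinearMap.proj a
  have hcirc : ∀ F : Finset A, ↑F ⊆ C.1 →
      infKer (D.circulations C.1) (Finset.univ \ F) ℓ = D.circulations F := by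
    intro F hF
    ext x
    simp only [mem_infKer, Finset.mem_sdiff, Finset.mem_univ, true_and]
    constructor
    · rintro ⟨hx, h⟩
      exact D.mem_circulations_of_forall_notMem hx fun a ha => h a ha
    · exact fun hx => ⟨D.circulations_mono hF hx, fun a ha => ((D.mem_circulations).1 hx).2 a ha⟩
  have hface : ∀ F : Finset A, IsConeFace (D.circulations C.1) Finset.univ ℓ F ↔
      ↑F ⊆ C.1 ∧ D.IsCycleUnion F := by
    intro F
    rw [isCycleUnion_iff_isCirculationSupport]
    constructor
    · rintro ⟨x, hx, h⟩
      refine ⟨fun a ha => ?_, x, D.mem_circulations_of_forall_notMem hx fun a ha =>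
        (h a (Finset.mem_univ a)).2 ha, fun a ha => (h a (Finset.mem_univ a)).1 ha⟩
      by_contra hc
      exact ((h a (Finset.mem_univ a)).1 ha).ne' (((D.mem_circulations).1 hx).2 a hc)
    · rintro ⟨hF, x, hx, h⟩
      exact ⟨x, D.circulations_mono hF hx, fun a _ =>
        ⟨fun ha => h a ha, fun ha => ((D.mem_circulations).1 hx).2 a ha⟩⟩
  have hproper : IsProperCone (D.circulations C.1) Finset.univ ℓ := by
    obtain ⟨x, hx, hpos⟩ := (D.isCycleUnion_iff_isCirculationSupport).1 C.2
    obtain ⟨a, ha⟩ := hC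
    refine ⟨x, hx, fun b _ => ?_, a, Finset.mem_univ a, (hpos a ha).ne'⟩
    by_cases hb : b ∈ C.1
    · exact (hpos b hb).le
    · exact (((D.mem_circulations).1 hx).2 b hb).ge
  have h := coneEulerSum_eq_coneEulerChar (D.circulations C.1) Finset.univ ℓ
  rw [coneEulerChar, if_pos hproper, coneEulerSum, ← Finset.sum_filter] at h
  rw [← h]
  refine Finset.sum_bij (fun Y _ => Y.1.toFinset) (fun Y hY => ?_) (fun Y _ Y' _ hYY' => ?_)
    (fun F hF => ?_) (fun Y hY => ?_)
  · have hYC : Y.1 ⊆ C.1 := (Finset.mem_filter.1 hY).2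
    simp [hface, hYC, Y.2]
  · exact Subtype.ext (Set.toFinset_inj.1 hYY')
  · have hF := (hface F).1 (Finset.mem_filter.1 hF).2
    exact ⟨⟨F, hF.2⟩, Finset.mem_filter.2 ⟨Finset.mem_univ _, hF.1⟩, by simp⟩
  · have hYC : Y.1 ⊆ C.1 := (Finset.mem_filter.1 hY).2
    rw [hcirc _ (by simpa using hYC), Set.coe_toFinset]

open Classical in
theorem mu_all_eq_neg_one_pow (C : D.CyclePoset) :
    IncidenceAlgebra.mu ℤ (CyclePoset.all D) C =
      (-1) ^ Module.finrank ℚ (D.circulations C.1) := by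
  induction C using WellFoundedLT.induction with
  | ind C ih =>
  rw [IncidenceAlgebra.mu_apply]
  split_ifs with hC
  · rw [← hC, CyclePoset.all, finrank_circulations_empty, pow_zero]
  · have hne : C.1.Nonempty := Set.nonempty_iff_ne_empty.2 fun h => hC (Subtype.ext h.symm)
    have h := D.sum_neg_one_pow_finrank_circulations hne
    -- Separating the top term `C` turns the vanishing sum into the recursion that defines `μ`.
    have hset : (Finset.univ.filter fun Y : D.CyclePoset => Y ≤ C) =
        insert C (Finset.Ico (CyclePoset.all D) C) := by
      ext Y
      have h0 : CyclePoset.all D ≤ Y := Set.empty_subset Y.1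
      simp [h0, le_iff_eq_or_lt]
    rw [hset, Finset.sum_insert Finset.right_notMem_Ico] at h
    rw [Finset.sum_congr rfl fun Y hY => ih Y (Finset.mem_Ico.1 hY).2]
    linarith

end MultiDigraph

theorem mainTheorem3 {V A : Type*} [Fintype V] [Fintype A] (D : MultiDigraph V A) :
    IsRankFunction D.rkQ ∧
      D.nlCoflowPolynomial =
        ∑ B : D.TotallyCyclicPoset, (-1 : ℤ[X]) ^ D.rkQ B * X ^ D.rkContract B.1 := by
  refine ⟨D.isRankFunction_rkQ, ?_⟩
  refine Fintype.sum_equiv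
    (Equiv.subtypeEquivRight fun _ => D.isCycleUnion_iff_isTotallyCyclic) _ _ fun C => ?_
  rw [MultiDigraph.mu_all_eq_neg_one_pow, MultiDigraph.rkQ_eq_finrank_circulations, map_pow, map_neg, map_one]
  rfl
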